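/- Let $B\subset\mathbb{R}^2$ be a union of finitely many line segments and let $K\subset\mathbb{R}^2$ be a convex body (a non-empty compact convex set) with interior points. Write $\mathcal{H}^1$ for one-dimensional Hausdorff measure. The set $B$ is called a weak barrier for $K$ if, for every unit vector $u$, $$\int_{u^\perp}\#\big(B\cap(x+\mathbb{R}u)\big)\,\mathcal{H}^1(\mathrm{d}x)\ \ge\ \mathcal{H}^1(K|u^\perp),$$ where $u^\perp$ is the line through the origin orthogonal to $u$ and $K|u^\perp$ is the orthogonal projection of $K$ onto it. The convexification $\mathrm{co}(B)$ is defined as follows. Write $B$ as a finite union of segments any two of which share at most one point, order these segments according to increasing angles in $[0,\pi)$ with respect to the horizontal axis, fit translates of them together in this order to form a polygonal curve, and translate this curve such that the midpoint of its endpoints is the origin. Then $\mathrm{co}(B)$ is the (possibly degenerate) convex polygon bounded by this curve and its reflection at the origin, that is, the convex hull of their union. The set $\mathrm{co}(B)$ exists and depends only on $B$, not on the choice of the segments, and with $\nabla K=\tfrac12(K+(-K))$, $$B\text{ is a weak barrier for }K\iff\nabla K\subset\mathrm{co}(B).$$ In particular, if $B$ is a weak barrier for $K$, then Jones' bound $\mathcal{H}^1(B)\ge\tfrac12\,\mathcal{H}^1(\partial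 K)$ holds. -/

import Mathlib

open MeasureTheory
open scoped Pointwise ENNReal

/-- The Euclidean plane. -/
abbrev Plane : Type := EuclideanSpace ℝ (Fin 2)

/-- `B` is a union of finitely many line segments. The segments may cross and overlap, they may
degenerate to points, and there may be none of them. -/
def IsFiniteUnionOfSegments (B : Set Plane) : Prop :=
  ∃ (m : ℕ) (a b : Fin m → Plane), B = ⋃ i, segment ℝ (a i) (b i)

/-- The line through `x` parallel to `u`. -/
def lineThrough (x u : Plane) : Set Plane :=
  Set.range fun t : ℝ => x + t • u

/-- Total projection length of `B` onto the line orthogonal to `u`, with multiplicities: the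
integral over `x ∈ u^⊥` of the number of points of `B` on the line through `x` parallel to `u`. -/
noncomputable def totalProjectionLength (B : Set Plane) (u : Plane) : ℝ≥0∞ :=
  ∫⁻ x in ((Submodule.span ℝ {u})ᗮ : Set Plane),
    ((B ∩ lineThrough x u).encard : ℝ≥0∞) ∂(μH[1] : Measure Plane)

/-- Length of the orthogonal projection of `K` onto the line orthogonal to `u`. -/
noncomputable def projectionLength (K : Set Plane) (u : Plane) : ℝ≥0∞ :=
  (μH[1] : Measure Plane) ((Submodule.span ℝ {u})ᗮ.starProjection '' K)

/-- `B` is a weak barrier for `K`: in every direction, the total projection length of `B`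
with multiplicities is at least the projection length of `K`. -/
def IsWeakBarrier (B K : Set Plane) : Prop :=
  ∀ u : Plane, ‖u‖ = 1 → projectionLength K u ≤ totalProjectionLength B u

/-- The central symmetral `½ (K + (-K))`. -/
def centralSymmetral (K : Set Plane) : Set Plane :=
  (1 / 2 : ℝ) • (K + -K)

/-- The angle in `(-π, π]` of the vector `v` with the positive horizontal axis
(`0` for `v = 0`). -/
noncomputable def horizontalAngle (v : Plane) : ℝ :=
  Complex.arg ⟨v 0, v 1⟩

/-- `B` is the union of the segments `[a i, b i]`, any two of which share at most one point, and
these are listed according to increasing angles in `[0, π)` with respect to the horizontal axis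
(the endpoints of each segment are named so that the angle of `b i - a i` is in `[0, π)`). -/
structure IsOrderedDecomposition (B : Set Plane) {m : ℕ} (a b : Fin m → Plane) : Prop where
  eq_iUnion : B = ⋃ i, segment ℝ (a i) (b i)
  nonoverlapping : ∀ i j, i ≠ j →
    (segment ℝ (a i) (b i) ∩ segment ℝ (a j) (b j)).Subsingleton
  angle_mem : ∀ i, horizontalAngle (b i - a i) ∈ Set.Ico 0 Real.pi
  angle_mono : Monotone fun i => horizontalAngle (b i - a i)

/-- The vertices `p 0, p 1, …, p m` of the polygonal curve with successive edge vectors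
`e 0, …, e (m - 1)` whose endpoints `p 0` and `p m` have the origin as midpoint
(`p k = p m` for `k ≥ m`). -/
noncomputable def curveVertex {m : ℕ} (e : Fin m → Plane) (k : ℕ) : Plane :=
  (∑ i ∈ Finset.univ.filter (fun i : Fin m => (i : ℕ) < k), e i) - (1 / 2 : ℝ) • ∑ i, e i

/-- The polygonal curve with successive edge vectors `e 0, …, e (m - 1)` whose endpoints have the
origin as midpoint. The index `k = m` adds the end point only, so that the curve
is a single point when `m = 0`. -/
noncomputable def polygonalCurve {m : ℕ} (e : Fin m → Plane) : Set Plane :=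
  ⋃ k ∈ Finset.range (m + 1), segment ℝ (curveVertex e k) (curveVertex e (k + 1))

/-- `C` is the convexification of `B`: the segments of `B`, ordered by angle, are fitted together
to form a polygonal curve, centred such that the midpoint of its endpoints is the origin; `C` is
the convex polygon bounded by this curve and its reflection at the origin, that is, their
convex hull (a segment or a point if the segments of `B` are all parallel or trivial). -/
def IsConvexification (B C : Set Plane) : Prop :=
  ∃ (m : ℕ) (a b : Fin m → Plane), IsOrderedDecomposition B a b ∧
    C = convexHull ℝ (polygonalCurve (fun i => b i - a i) ∪ -polygonalCurve (fun i => b i - a i))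

/-! Let f(θ) be the total projection length of B along `dir (θ - π/2)` and h the support function of
K. If B is a nonoverlapping union of segments with edge vectors eᵢ, then f(θ) = Σ |⟨eᵢ, dir θ⟩|,
since all but finitely many lines of that direction meet each segment at most once and no two
segments in a common point (`totalProjectionLength_iUnion_segment`). The convexification is the
zonotope with support function f/2: its vertices are signed half-sums of the eᵢ, and the order by
angle provides, for each direction, a vertex with the right signs (`convexHull_polygonalCurve_eq`).
As f depends on B alone, so does the convexification. The width h(θ) + h(θ + π) is both the
projection length of K and twice the support function of ∇K, so both sides of the equivalence say
that it is at most f(θ) for all θ.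

Jones' bound comes from a discrete Cauchy formula. Put δ = π/M. Moving the boundary points of K
along outer normals onto the circumscribed 2M-gon with normals `dir (k * δ)` does not decrease
distances, so the boundary of K has length at most 2 tan(δ/2) Σ h(kδ)
(`hausdorffMeasure_frontier_le`). Pairing opposite directions and comparing Σ |cos| with ∫ |cos| = 4
bounds this by 2 Σ ‖eᵢ‖ / cos(δ/2); then M → ∞. -/

/-! ### Directions and lines, parametrised by angle. -/

/-- The unit vector at angle `θ` with the horizontal axis. -/
noncomputable def dir (θ : ℝ) : Plane := !₂[Real.cos θ, Real.sin θ]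

theorem inner_dir (x : Plane) (θ : ℝ) :
    inner ℝ x (dir θ) = x 0 * Real.cos θ + x 1 * Real.sin θ := by
  simp [dir, PiLp.inner_apply, Fin.sum_univ_two, mul_comm]

theorem norm_dir (θ : ℝ) : ‖dir θ‖ = 1 := by
  simp [dir, EuclideanSpace.norm_eq, Fin.sum_univ_two]

theorem dir_add_pi (θ : ℝ) : dir (θ + Real.pi) = -dir θ := by
  ext i; fin_cases i <;> simp [dir]

theorem dir_add_two_pi (θ : ℝ) : dir (θ + 2 * Real.pi) = dir θ := by
  simp [dir]

theorem eq_norm_smul_dir_horizontalAngle (v : Plane) : v = ‖v‖ • dir (horizontalAngle v) := by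
  have hn : ‖(⟨v 0, v 1⟩ : ℂ)‖ = ‖v‖ := by
    rw [EuclideanSpace.norm_eq, Complex.norm_def, Complex.normSq_mk]
    simp [Fin.sum_univ_two, sq]
  have h0 := Complex.norm_mul_cos_arg ⟨v 0, v 1⟩
  have h1 := Complex.norm_mul_sin_arg ⟨v 0, v 1⟩
  rw [hn] at h0 h1
  ext i; fin_cases i
  · simpa [dir, horizontalAngle] using h0.symm
  · simpa [dir, horizontalAngle] using h1.symm

theorem dir_sub_pi_div_two (θ : ℝ) :
    dir (θ - Real.pi / 2) = !₂[Real.sin θ, -Real.cos θ] := by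
  simp [dir, Real.cos_sub_pi_div_two, Real.sin_sub_pi_div_two]

/-- The shift by π/2 makes `dir θ` the unit vector of the line projected onto, so that projections
are read off as inner products with `dir θ`. -/
theorem orthogonal_span_dir (θ : ℝ) :
    (Submodule.span ℝ {dir (θ - Real.pi / 2)})ᗮ = Submodule.span ℝ {dir θ} := by
  ext v
  rw [Submodule.mem_orthogonal_singleton_iff_inner_right, real_inner_comm, inner_dir,
    Real.cos_sub_pi_div_two, Real.sin_sub_pi_div_two, Submodule.mem_span_singleton]
  constructor
  · intro h
    refine ⟨v 0 * Real.cos θ + v 1 * Real.sin θ, ?_⟩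
    have h2 := Real.sin_sq_add_cos_sq θ
    ext i; fin_cases i
    · simp [dir]; linear_combination (v 0) * h2 - Real.sin θ * h
    · simp [dir]; linear_combination (v 1) * h2 + Real.cos θ * h
  · rintro ⟨r, rfl⟩
    simp [dir]; ring

theorem isometry_smul_dir (θ : ℝ) : Isometry fun t : ℝ => t • dir θ := by
  refine Isometry.of_dist_eq fun s t => ?_
  rw [dist_eq_norm, ← sub_smul, norm_smul, norm_dir, mul_one, Real.dist_eq, Real.norm_eq_abs]

theorem range_smul_dir (θ : ℝ) :
    Set.range (fun t : ℝ => t • dir θ) =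
      ((Submodule.span ℝ {dir (θ - Real.pi / 2)})ᗮ : Set Plane) := by
  rw [orthogonal_span_dir]
  ext v
  simp [Submodule.mem_span_singleton]

theorem lineThrough_smul_dir (t θ : ℝ) :
    lineThrough (t • dir θ) (dir (θ - Real.pi / 2)) = {y | inner ℝ y (dir θ) = t} := by
  ext y
  have h2 := Real.sin_sq_add_cos_sq θ
  simp only [lineThrough, Set.mem_range, Set.mem_ofPred_eq, inner_dir, dir_sub_pi_div_two]
  constructor
  · rintro ⟨s, rfl⟩
    simp [dir]; linear_combination t * h2
  · rintro rfl
    refine ⟨y 0 * Real.sin θ - y 1 * Real.cos θ, ?_⟩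
    ext i; fin_cases i
    · simp [dir]; linear_combination (y 0) * h2
    · simp [dir]; linear_combination (y 1) * h2

/-! ### Projection lengths of convex sets and of unions of segments. -/

/-- The support function of `K`, as a function of the angle of the direction. -/
noncomputable def supportFun (K : Set Plane) (θ : ℝ) : ℝ :=
  sSup ((fun x => inner ℝ x (dir θ)) '' K)

theorem isCompact_image_inner_dir {K : Set Plane} (hK : IsCompact K) (θ : ℝ) :
    IsCompact ((fun x => inner ℝ x (dir θ)) '' K) :=
  hK.image (by fun_prop)

theorem inner_le_supportFun {K : Set Plane} (hK : IsCompact K) {x : Plane} (hx : x ∈ K) (θ : ℝ) :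
    inner ℝ x (dir θ) ≤ supportFun K θ :=
  le_csSup (isCompact_image_inner_dir hK θ).bddAbove ⟨x, hx, rfl⟩

theorem exists_inner_eq_supportFun {K : Set Plane} (hK : IsCompact K) (hne : K.Nonempty) (θ : ℝ) :
    ∃ x ∈ K, inner ℝ x (dir θ) = supportFun K θ :=
  (isCompact_image_inner_dir hK θ).sSup_mem (hne.image _)

theorem supportFun_add_two_pi (K : Set Plane) (θ : ℝ) :
    supportFun K (θ + 2 * Real.pi) = supportFun K θ := by
  simp only [supportFun, dir_add_two_pi]

theorem image_inner_dir_eq_Icc {K : Set Plane} (hK : IsCompact K) (hne : K.Nonempty)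
    (hc : Convex ℝ K) (θ : ℝ) :
    (fun x => inner ℝ x (dir θ)) '' K =
      Set.Icc (-supportFun K (θ + Real.pi)) (supportFun K θ) := by
  obtain ⟨x, hx, hx'⟩ := exists_inner_eq_supportFun hK hne θ
  obtain ⟨y, hy, hy'⟩ := exists_inner_eq_supportFun hK hne (θ + Real.pi)
  rw [dir_add_pi, inner_neg_right] at hy'
  apply Set.Subset.antisymm
  · rintro _ ⟨z, hz, rfl⟩
    have h := inner_le_supportFun hK hz (θ + Real.pi)
    rw [dir_add_pi, inner_neg_right] at h
    exact ⟨by linarith, inner_le_supportFun hK hz θ⟩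
  · rw [← hx', ← hy', neg_neg]
    have hpre : IsPreconnected ((fun x => inner ℝ x (dir θ)) '' K) :=
      hc.isPreconnected.image _ (by fun_prop)
    exact hpre.Icc_subset ⟨y, hy, rfl⟩ ⟨x, hx, rfl⟩

theorem projectionLength_dir {K : Set Plane} (hK : IsCompact K) (hne : K.Nonempty)
    (hc : Convex ℝ K) (θ : ℝ) :
    projectionLength K (dir (θ - Real.pi / 2)) =
      ENNReal.ofReal (supportFun K θ + supportFun K (θ + Real.pi)) := by
  have h : ((Submodule.span ℝ {dir (θ - Real.pi / 2)})ᗮ).starProjection '' K =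
      (fun t : ℝ => t • dir θ) '' ((fun x => inner ℝ x (dir θ)) '' K) := by
    rw [Set.image_image]
    refine Set.image_congr fun x _ => ?_
    simp only [orthogonal_span_dir]
    rw [Submodule.starProjection_unit_singleton ℝ (norm_dir θ), real_inner_comm]
  rw [projectionLength, h, (isometry_smul_dir θ).hausdorffMeasure_image (Or.inl zero_le_one),
    hausdorffMeasure_real, image_inner_dir_eq_Icc hK hne hc, Real.volume_Icc, sub_neg_eq_add]

theorem totalProjectionLength_dir (B : Set Plane) (θ : ℝ) :
    totalProjectionLength B (dir (θ - Real.pi / 2)) =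
      ∫⁻ t : ℝ, ((B ∩ {y | inner ℝ y (dir θ) = t}).encard : ℝ≥0∞) := by
  rw [totalProjectionLength, ← range_smul_dir,
    ← (isometry_smul_dir θ).map_hausdorffMeasure (Or.inl zero_le_one), hausdorffMeasure_real,
    (isometry_smul_dir θ).isClosedEmbedding.measurableEmbedding.lintegral_map]
  simp only [lineThrough_smul_dir]

theorem image_inner_segment (a b n : Plane) :
    (fun x => inner ℝ x n) '' segment ℝ a b = segment ℝ (inner ℝ a n) (inner ℝ b n) := by
  simp only [fun x : Plane => real_inner_comm n x]
  exact image_segment ℝ ((innerₗ Plane n).toAffineMap) a b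

/-- The hypothesis `ht` only discards the level of a segment orthogonal to `n`, which lies entirely
on one line. -/
theorem encard_segment_inter {a b n : Plane} {t : ℝ}
    (ht : inner ℝ (b - a) n = 0 → t ≠ inner ℝ a n) :
    ((segment ℝ a b ∩ {y | inner ℝ y n = t}).encard : ℝ≥0∞) =
      ((fun x => inner ℝ x n) '' segment ℝ a b).indicator 1 t := by
  by_cases hmem : t ∈ (fun x => inner ℝ x n) '' segment ℝ a b
  · rw [Set.indicator_of_mem hmem]
    obtain ⟨y, hy, hyt⟩ := hmem
    have : segment ℝ a b ∩ {y | inner ℝ y n = t} = {y} := by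
      refine Set.eq_singleton_iff_unique_mem.2 ⟨⟨hy, hyt⟩, ?_⟩
      rintro z ⟨hz, hzt⟩
      rw [segment_eq_image'] at hy hz
      obtain ⟨r, -, rfl⟩ := hy
      obtain ⟨s, -, rfl⟩ := hz
      simp only [Set.mem_ofPred_eq, inner_add_left, inner_smul_left] at hyt hzt
      have hc : inner ℝ (b - a) n ≠ 0 := by
        intro h0
        exact ht h0 (by simpa [h0] using hyt.symm)
      have : s = r := mul_right_cancel₀ hc (by simp at hyt hzt; linarith)
      rw [this]
    simp [this]
  · rw [Set.indicator_of_notMem hmem]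
    have : segment ℝ a b ∩ {y | inner ℝ y n = t} = ∅ := by
      ext y
      simp only [Set.mem_inter_iff, Set.mem_ofPred_eq, Set.mem_empty_iff_false, iff_false]
      rintro ⟨hy, hyt⟩
      exact hmem ⟨y, hy, hyt⟩
    simp [this]

theorem toENNReal_sum {ι : Type*} (s : Finset ι) (f : ι → ℕ∞) :
    ((∑ i ∈ s, f i : ℕ∞) : ℝ≥0∞) = ∑ i ∈ s, (f i : ℝ≥0∞) := by
  classical
  induction s using Finset.induction_on with
  | empty => simp
  | insert i s hi ih => rw [Finset.sum_insert hi, Finset.sum_insert hi, ENat.toENNReal_add, ih]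

theorem totalProjectionLength_iUnion_segment {m : ℕ} {a b : Fin m → Plane}
    (h : ∀ i j, i ≠ j → (segment ℝ (a i) (b i) ∩ segment ℝ (a j) (b j)).Subsingleton) (θ : ℝ) :
    totalProjectionLength (⋃ i, segment ℝ (a i) (b i)) (dir (θ - Real.pi / 2)) =
      ENNReal.ofReal (∑ i, |inner ℝ (b i - a i) (dir θ)|) := by
  set n := dir θ with hn
  -- The exceptional levels: those of segments possibly contained in a line, and those of common
  -- points of two segments.
  have hfin : (Set.range (fun i => inner ℝ (a i) n) ∪ ⋃ p : {p : Fin m × Fin m // p.1 ≠ p.2},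
      (fun x => inner ℝ x n) '' (segment ℝ (a p.1.1) (b p.1.1) ∩ segment ℝ (a p.1.2) (b p.1.2))
      ).Finite :=
    (Set.finite_range _).union (Set.finite_iUnion fun p => ((h _ _ p.2).finite).image _)
  rw [totalProjectionLength_dir]
  calc _ = ∫⁻ t : ℝ, ∑ i, ((fun x => inner ℝ x n) '' segment ℝ (a i) (b i)).indicator 1 t := by
        refine lintegral_congr_ae ?_
        filter_upwards [measure_eq_zero_iff_ae_notMem.1 (hfin.measure_zero volume)] with t ht
        rw [Set.mem_union, not_or, Set.mem_range, not_exists, Set.mem_iUnion, not_exists] at ht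
        rw [Set.iUnion_inter, Set.encard_iUnion_of_finite, finsum_eq_sum_of_fintype, toENNReal_sum]
        · exact Finset.sum_congr rfl fun i _ =>
            encard_segment_inter fun _ h' => ht.1 i h'.symm
        · intro i j hij
          refine Set.disjoint_left.2 ?_
          rintro x ⟨hxi, hx⟩ ⟨hxj, -⟩
          exact ht.2 ⟨(i, j), hij⟩ ⟨x, ⟨hxi, hxj⟩, hx⟩
    _ = ∑ i, volume ((fun x => inner ℝ x n) '' segment ℝ (a i) (b i)) := by
        have hm : ∀ i, MeasurableSet ((fun x => inner ℝ x n) '' segment ℝ (a i) (b i)) := by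
          intro i
          rw [image_inner_segment, segment_eq_uIcc]
          exact measurableSet_uIcc
        rw [lintegral_finsetSum _ fun i _ => measurable_one.indicator (hm i)]
        exact Finset.sum_congr rfl fun i _ => lintegral_indicator_one (hm i)
    _ = _ := by
        rw [ENNReal.ofReal_sum_of_nonneg fun _ _ => abs_nonneg _]
        refine Finset.sum_congr rfl fun i _ => ?_
        rw [image_inner_segment, ← hausdorffMeasure_real, hausdorffMeasure_segment, edist_comm,
          edist_dist, Real.dist_eq, inner_sub_left]

/-! ### Existence of ordered decompositions. -/

theorem segment_subset_line {a b p q : Plane} (hp : p ∈ segment ℝ a b) (hq : q ∈ segment ℝ a b)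
    (hpq : p ≠ q) : ∃ α β : ℝ, segment ℝ a b = AffineMap.lineMap p q '' segment ℝ α β := by
  rw [segment_eq_image'] at hp hq
  obtain ⟨s, -, rfl⟩ := hp
  obtain ⟨t, -, rfl⟩ := hq
  have hst : t - s ≠ 0 := by
    intro h
    exact hpq (by rw [sub_eq_zero.1 h])
  refine ⟨-s / (t - s), (1 - s) / (t - s), ?_⟩
  rw [image_segment]
  congr 1
  · rw [AffineMap.lineMap_apply_module']
    rw [add_sub_add_left_eq_sub, ← sub_smul, smul_smul, div_mul_cancel₀ _ hst]
    module
  · rw [AffineMap.lineMap_apply_module']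
    rw [add_sub_add_left_eq_sub, ← sub_smul, smul_smul, div_mul_cancel₀ _ hst]
    module

/-- Two common points put both segments on one line, where they become intersecting intervals. -/
theorem exists_segment_union_eq {a b c d p q : Plane} (hp : p ∈ segment ℝ a b ∩ segment ℝ c d)
    (hq : q ∈ segment ℝ a b ∩ segment ℝ c d) (hpq : p ≠ q) :
    ∃ x y, segment ℝ x y = segment ℝ a b ∪ segment ℝ c d := by
  obtain ⟨α, β, h₁⟩ := segment_subset_line hp.1 hq.1 hpq
  obtain ⟨γ, δ, h₂⟩ := segment_subset_line hp.2 hq.2 hpq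
  have hinj : Function.Injective (AffineMap.lineMap p q : ℝ → Plane) :=
    AffineMap.lineMap_injective ℝ hpq
  have hne : (Set.uIcc α β ∩ Set.uIcc γ δ).Nonempty := by
    rw [h₁, h₂, segment_eq_uIcc, segment_eq_uIcc, ← Set.image_inter hinj] at hp
    exact Set.Nonempty.of_image ⟨p, hp⟩
  have hu : segment ℝ (min (min α β) (min γ δ)) (max (max α β) (max γ δ)) =
      segment ℝ α β ∪ segment ℝ γ δ := by
    obtain ⟨r, hr₁, hr₂⟩ := hne
    simp only [segment_eq_uIcc, Set.uIcc, Set.mem_Icc] at *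
    rw [Set.Icc_union_Icc' (hr₂.1.trans hr₁.2) (hr₁.1.trans hr₂.2), inf_eq_left.2, sup_eq_right.2]
    all_goals simp
  refine ⟨AffineMap.lineMap p q (min (min α β) (min γ δ)),
    AffineMap.lineMap p q (max (max α β) (max γ δ)), ?_⟩
  rw [h₁, h₂, ← Set.image_union, ← hu, image_segment]

theorem exists_nonoverlapping {B : Set Plane} (hB : IsFiniteUnionOfSegments B) :
    ∃ (m : ℕ) (a b : Fin m → Plane), B = ⋃ i, segment ℝ (a i) (b i) ∧
      ∀ i j, i ≠ j → (segment ℝ (a i) (b i) ∩ segment ℝ (a j) (b j)).Subsingleton := by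
  classical
  -- With the least possible number of segments nothing overlaps, since an overlapping pair could be
  -- merged.
  obtain ⟨a, b, hab⟩ := Nat.find_spec hB
  refine ⟨_, a, b, hab, fun i j hij p hp q hq => ?_⟩
  by_contra hpq
  obtain ⟨x, y, hxy⟩ := exists_segment_union_eq hp hq hpq
  have hmin := fun n => Nat.find_min (m := n) hB
  revert a b hmin
  generalize Nat.find hB = m at i j
  intro a b hab hp hq hxy hmin
  cases m with
  | zero => exact i.elim0
  | succ n =>
    obtain ⟨k, rfl⟩ := Fin.exists_succAbove_eq hij.symm
    refine hmin n n.lt_succ_self ⟨Function.update (a ∘ i.succAbove) k x,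
      Function.update (b ∘ i.succAbove) k y, hab.trans ?_⟩
    ext z
    simp only [Set.mem_iUnion]
    rw [Fin.exists_iff_succAbove i]
    constructor
    · rintro (hz | ⟨l, hl⟩)
      · refine ⟨k, ?_⟩
        simp only [Function.update_self]
        rw [hxy]; exact Or.inl hz
      · by_cases hlk : l = k
        · subst hlk
          refine ⟨l, ?_⟩
          simp only [Function.update_self]
          rw [hxy]; exact Or.inr hl
        · exact ⟨l, by simpa [Function.update_of_ne hlk] using hl⟩
    · rintro ⟨l, hl⟩
      by_cases hlk : l = k
      · subst hlk
        simp only [Function.update_self] at hl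
        rw [hxy] at hl
        exact hl.imp id fun h => ⟨l, h⟩
      · exact Or.inr ⟨l, by simpa [Function.update_of_ne hlk] using hl⟩

theorem horizontalAngle_mem_or_neg_mem (v : Plane) :
    horizontalAngle v ∈ Set.Ico 0 Real.pi ∨ horizontalAngle (-v) ∈ Set.Ico 0 Real.pi := by
  have key : ∀ w : Plane, (0 < w 1 ∨ w 1 = 0 ∧ 0 ≤ w 0) → horizontalAngle w ∈ Set.Ico 0 Real.pi := by
    intro w hw
    refine ⟨Complex.arg_nonneg_iff.2 ?_, (Complex.arg_le_pi _).lt_of_ne fun h => ?_⟩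
    · rcases hw with hw | hw
      · exact hw.le
      · exact hw.1.ge
    · have := Complex.arg_eq_pi_iff.1 h
      rcases hw with hw | hw
      · exact hw.ne' this.2
      · exact hw.2.not_gt this.1
  rcases lt_trichotomy (v 1) 0 with h | h | h
  · exact Or.inr (key _ (Or.inl (by simpa using h)))
  · rcases le_total 0 (v 0) with h0 | h0
    · exact Or.inl (key _ (Or.inr ⟨h, h0⟩))
    · exact Or.inr (key _ (Or.inr ⟨by simpa using h, by simpa using h0⟩))
  · exact Or.inl (key _ (Or.inl h))

theorem exists_isOrderedDecomposition {B : Set Plane} (hB : IsFiniteUnionOfSegments B) :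
    ∃ (m : ℕ) (a b : Fin m → Plane), IsOrderedDecomposition B a b := by
  obtain ⟨m, a, b, hab, hn⟩ := exists_nonoverlapping hB
  have hflip : ∀ i, ∃ p : Plane × Plane, segment ℝ p.1 p.2 = segment ℝ (a i) (b i) ∧
      horizontalAngle (p.2 - p.1) ∈ Set.Ico 0 Real.pi := by
    intro i
    rcases horizontalAngle_mem_or_neg_mem (b i - a i) with h | h
    · exact ⟨(a i, b i), rfl, h⟩
    · exact ⟨(b i, a i), segment_symm ℝ _ _, by rwa [neg_sub] at h⟩
  choose p hp hp' using hflip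
  set σ := Tuple.sort fun i => horizontalAngle ((p i).2 - (p i).1) with hσ
  refine ⟨m, fun i => (p (σ i)).1, fun i => (p (σ i)).2, ?_, ?_, fun i => hp' _, ?_⟩
  · simp only [hp]
    rw [hab]
    exact (σ.surjective.iUnion_comp fun i => segment ℝ (a i) (b i)).symm
  · intro i j hij
    simp only [hp]
    exact hn _ _ (σ.injective.ne hij)
  · exact Tuple.monotone_sort fun i => horizontalAngle ((p i).2 - (p i).1)

/-! ### The convexification as an intersection of half-planes. -/

/-- Centring turns each vertex into a half-sum of all edges, with sign + for those already traversed
and - for the rest. -/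
theorem inner_curveVertex {m : ℕ} (e : Fin m → Plane) (k : ℕ) (n : Plane) :
    inner ℝ (curveVertex e k) n =
      ∑ i : Fin m, (if (i : ℕ) < k then 1 / 2 else -(1 / 2)) * inner ℝ (e i) n := by
  rw [curveVertex, inner_sub_left, inner_smul_left, sum_inner, sum_inner, Finset.sum_filter,
    Finset.mul_sum, ← Finset.sum_sub_distrib]
  refine Finset.sum_congr rfl fun i _ => ?_
  simp only [conj_trivial]
  split_ifs <;> ring

theorem abs_inner_curveVertex_le {m : ℕ} (e : Fin m → Plane) (k : ℕ) (n : Plane) :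
    |inner ℝ (curveVertex e k) n| ≤ 1 / 2 * ∑ i, |inner ℝ (e i) n| := by
  rw [inner_curveVertex, Finset.mul_sum]
  refine (Finset.abs_sum_le_sum_abs _ _).trans (Finset.sum_le_sum fun i _ => ?_)
  rw [abs_mul]
  refine le_of_eq ?_
  congr 1
  split_ifs <;> norm_num [abs_of_pos]

theorem fin_exists_forall_iff_lt {m : ℕ} {P : Fin m → Prop} (hP : ∀ i j, i ≤ j → P j → P i) :
    ∃ k ≤ m, ∀ i : Fin m, P i ↔ (i : ℕ) < k := by
  classical
  have hex : ∃ k, ∀ h : k < m, ¬ P ⟨k, h⟩ := ⟨m, fun h => absurd h (lt_irrefl _)⟩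
  refine ⟨Nat.find hex, Nat.find_min' hex fun h => absurd h (lt_irrefl _), fun i => ?_⟩
  constructor
  · intro hi
    by_contra hlt
    rw [not_lt] at hlt
    exact Nat.find_spec hex (hlt.trans_lt i.2) (hP _ i hlt hi)
  · intro hi
    have := Nat.find_min hex hi
    push Not at this
    exact this.2

theorem exists_abs_inner_dir_eq (θ : ℝ) : ∃ φ ∈ Set.Ioc (-(Real.pi / 2)) (Real.pi / 2),
    ∀ x : Plane, |inner ℝ x (dir φ)| = |inner ℝ x (dir θ)| := by
  refine ⟨toIocMod Real.pi_pos (-(Real.pi / 2)) θ, ?_, fun x => ?_⟩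
  · have h := toIocMod_mem_Ioc Real.pi_pos (-(Real.pi / 2)) θ
    rwa [show -(Real.pi / 2) + Real.pi = Real.pi / 2 by ring] at h
  · rw [toIocMod, zsmul_eq_mul, inner_dir, inner_dir, Real.cos_sub_int_mul_pi,
      Real.sin_sub_int_mul_pi]
    rw [show ∀ c u v y z : ℝ, u * (c * y) + v * (c * z) = c * (u * y + v * z) by intros; ring,
      abs_mul, abs_neg_one_zpow, one_mul]

/-- After reducing θ modulo π to φ in (-π/2, π/2], edges of angle at most φ + π/2 have nonnegative
inner product with `dir φ` and the others nonpositive. By monotonicity the former are an initial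
block, and its length is the index of the vertex. -/
theorem exists_le_abs_inner_curveVertex {m : ℕ} {e : Fin m → Plane}
    (h₀ : ∀ i, horizontalAngle (e i) ∈ Set.Ico 0 Real.pi)
    (hmono : Monotone fun i => horizontalAngle (e i)) (θ : ℝ) :
    ∃ k ≤ m, |inner ℝ (curveVertex e k) (dir θ)| = 1 / 2 * ∑ i, |inner ℝ (e i) (dir θ)| := by
  obtain ⟨φ, hφ, h⟩ := exists_abs_inner_dir_eq θ
  simp only [← h]
  obtain ⟨k, hkm, hk⟩ := fin_exists_forall_iff_lt
    (P := fun i => horizontalAngle (e i) ≤ φ + Real.pi / 2) fun i j hij hj => (hmono hij).trans hj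
  refine ⟨k, hkm, ?_⟩
  have he : ∀ i, inner ℝ (e i) (dir φ) = ‖e i‖ * Real.cos (horizontalAngle (e i) - φ) := by
    intro i
    conv_lhs => rw [eq_norm_smul_dir_horizontalAngle (e i)]
    rw [inner_smul_left, inner_dir, Real.cos_sub]
    simp [dir]
  have hsum : inner ℝ (curveVertex e k) (dir φ) = 1 / 2 * ∑ i, |inner ℝ (e i) (dir φ)| := by
    rw [inner_curveVertex, Finset.mul_sum]
    refine Finset.sum_congr rfl fun i _ => ?_
    have h₁ := h₀ i
    rw [Set.mem_Ico] at h₁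
    rw [Set.mem_Ioc] at hφ
    split_ifs with hik
    · rw [abs_of_nonneg]
      rw [he]
      have := (hk i).2 hik
      exact mul_nonneg (norm_nonneg _)
        (Real.cos_nonneg_of_mem_Icc ⟨by linarith, by linarith⟩)
    · rw [abs_of_nonpos]
      · ring
      rw [he]
      have := mt (hk i).1 hik
      rw [not_le] at this
      exact mul_nonpos_of_nonneg_of_nonpos (norm_nonneg _)
        (Real.cos_nonpos_of_pi_div_two_le_of_le (by linarith) (by linarith))
  rw [hsum, abs_of_nonneg]
  positivity

theorem convexHull_polygonalCurve_union_neg {m : ℕ} (e : Fin m → Plane) :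
    convexHull ℝ (polygonalCurve e ∪ -polygonalCurve e) =
      convexHull ℝ ((curveVertex e '' Set.Iic (m + 1)) ∪ -(curveVertex e '' Set.Iic (m + 1))) := by
  have key : polygonalCurve e ⊆ convexHull ℝ (curveVertex e '' Set.Iic (m + 1)) := by
    refine Set.iUnion₂_subset fun k hk => ?_
    rw [Finset.mem_range] at hk
    exact (convex_convexHull ℝ _).segment_subset
      (subset_convexHull ℝ _ ⟨k, hk.le, rfl⟩) (subset_convexHull ℝ _ ⟨k + 1, hk, rfl⟩)
  apply Set.Subset.antisymm
  · refine convexHull_min (Set.union_subset ?_ ?_) (convex_convexHull ℝ _)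
    · exact key.trans (convexHull_mono Set.subset_union_left)
    · refine (Set.neg_subset_neg.2 key).trans ?_
      rw [← convexHull_neg]
      exact convexHull_mono Set.subset_union_right
  · refine convexHull_mono ?_
    have h : curveVertex e '' Set.Iic (m + 1) ⊆ polygonalCurve e := by
      rintro _ ⟨k, hk, rfl⟩
      rw [polygonalCurve]
      rcases Nat.lt_or_ge k (m + 1) with h | h
      · exact Set.mem_iUnion₂.2 ⟨k, Finset.mem_range.2 h, left_mem_segment ℝ _ _⟩
      · obtain rfl : k = m + 1 := le_antisymm hk h
        exact Set.mem_iUnion₂.2 ⟨m, by simp, right_mem_segment ℝ _ _⟩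
    exact Set.union_subset_union h (Set.neg_subset_neg.2 h)

/-- A point outside the hull is strictly separated from it in some direction, but there a vertex or
its negative already attains the bound. -/
theorem convexHull_polygonalCurve_eq {m : ℕ} {e : Fin m → Plane}
    (h₀ : ∀ i, horizontalAngle (e i) ∈ Set.Ico 0 Real.pi)
    (hmono : Monotone fun i => horizontalAngle (e i)) :
    convexHull ℝ (polygonalCurve e ∪ -polygonalCurve e) =
      {x | ∀ θ, inner ℝ x (dir θ) ≤ 1 / 2 * ∑ i, |inner ℝ (e i) (dir θ)|} := by
  rw [convexHull_polygonalCurve_union_neg]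
  set V := curveVertex e '' Set.Iic (m + 1) with hV
  have hVfin : (V ∪ -V).Finite := by
    have := (Set.finite_Iic (m + 1)).image (curveVertex e)
    exact this.union this.neg
  apply Set.Subset.antisymm
  · refine convexHull_min ?_ ?_
    · rintro x (⟨k, -, rfl⟩ | ⟨k, -, hk⟩) θ
      · exact (le_abs_self _).trans (abs_inner_curveVertex_le e k _)
      · rw [← neg_neg x, ← hk, inner_neg_left]
        exact (neg_le_abs _).trans (abs_inner_curveVertex_le e k _)
    · intro x hx y hy s t hs ht hst θ
      rw [inner_add_left, inner_smul_left, inner_smul_left]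
      simp only [conj_trivial]
      have h₁ := mul_le_mul_of_nonneg_left (hx θ) hs
      have h₂ := mul_le_mul_of_nonneg_left (hy θ) ht
      calc _ ≤ _ := add_le_add h₁ h₂
        _ = _ := by rw [← add_mul, hst, one_mul]
  · intro x hx
    by_contra hxV
    obtain ⟨f, u, hf, hu⟩ := geometric_hahn_banach_closed_point (convex_convexHull ℝ (V ∪ -V))
      (hVfin.isClosed_convexHull ℝ) hxV
    set v := (InnerProductSpace.toDual ℝ Plane).symm f with hv
    have hfv : ∀ y, f y = inner ℝ y v := fun y => by
      rw [real_inner_comm, InnerProductSpace.toDual_symm_apply]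
    obtain ⟨θ, hθ⟩ : ∃ θ, v = ‖v‖ • dir θ := ⟨_, eq_norm_smul_dir_horizontalAngle v⟩
    obtain ⟨k, hkm, hk⟩ := exists_le_abs_inner_curveVertex h₀ hmono θ
    have hmem : curveVertex e k ∈ V := ⟨k, hkm.trans (Nat.le_succ m), rfl⟩
    have h₁ := hf _ (subset_convexHull ℝ _ (Or.inl hmem))
    have h₂ := hf (-curveVertex e k) (subset_convexHull ℝ _ (Or.inr (by simpa using hmem)))
    have h₃ := hx θ
    rw [hfv, hθ, inner_smul_right] at hu h₁ h₂
    rw [inner_neg_left] at h₂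
    have h₄ := mul_le_mul_of_nonneg_left h₃ (norm_nonneg v)
    rw [← hk] at h₄
    rcases abs_cases (inner ℝ (curveVertex e k) (dir θ)) with h | h
    · rw [h.1] at h₄; linarith
    · rw [h.1] at h₄; linarith

/-! ### Weak barriers and the central symmetral. -/

theorem sum_abs_inner_eq_totalProjectionLength {B : Set Plane} {m : ℕ} {a b : Fin m → Plane}
    (h : IsOrderedDecomposition B a b) (θ : ℝ) :
    ∑ i, |inner ℝ (b i - a i) (dir θ)| =
      (totalProjectionLength B (dir (θ - Real.pi / 2))).toReal := by
  rw [h.eq_iUnion, totalProjectionLength_iUnion_segment h.nonoverlapping, ENNReal.toReal_ofReal]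
  positivity

/-- No decomposition appears on the right-hand side, which is what gives uniqueness. -/
theorem IsConvexification.eq_setOf {B C : Set Plane} (h : IsConvexification B C) :
    C = {x | ∀ θ, inner ℝ x (dir θ) ≤
      1 / 2 * (totalProjectionLength B (dir (θ - Real.pi / 2))).toReal} := by
  obtain ⟨m, a, b, hab, rfl⟩ := h
  simp only [← sum_abs_inner_eq_totalProjectionLength hab]
  exact convexHull_polygonalCurve_eq hab.angle_mem hab.angle_mono

theorem existsUnique_isConvexification {B : Set Plane} (hB : IsFiniteUnionOfSegments B) :
    ∃! C : Set Plane, IsConvexification B C := by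
  obtain ⟨m, a, b, h⟩ := exists_isOrderedDecomposition hB
  exact ⟨_, ⟨m, a, b, h, rfl⟩, fun C hC => hC.eq_setOf.trans
    (IsConvexification.eq_setOf ⟨m, a, b, h, rfl⟩).symm⟩

theorem isWeakBarrier_iff {B K : Set Plane} (hB : IsFiniteUnionOfSegments B) (hK : IsCompact K)
    (hne : K.Nonempty) (hc : Convex ℝ K) :
    IsWeakBarrier B K ↔ ∀ θ, supportFun K θ + supportFun K (θ + Real.pi) ≤
      (totalProjectionLength B (dir (θ - Real.pi / 2))).toReal := by
  obtain ⟨m, a, b, h⟩ := exists_isOrderedDecomposition hB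
  have hfin : ∀ θ, totalProjectionLength B (dir (θ - Real.pi / 2)) ≠ ∞ := fun θ => by
    rw [h.eq_iUnion, totalProjectionLength_iUnion_segment h.nonoverlapping]
    exact ENNReal.ofReal_ne_top
  simp only [← ENNReal.ofReal_le_iff_le_toReal (hfin _), ← projectionLength_dir hK hne hc]
  constructor
  · exact fun hw θ => hw _ (norm_dir _)
  · intro hw u hu
    have := hw (horizontalAngle u + Real.pi / 2)
    have hu' := eq_norm_smul_dir_horizontalAngle u
    rw [hu, one_smul] at hu'
    rwa [add_sub_cancel_right, ← hu'] at this

theorem isWeakBarrier_iff_centralSymmetral_subset {B K C : Set Plane}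
    (hB : IsFiniteUnionOfSegments B) (hK : IsCompact K) (hne : K.Nonempty) (hc : Convex ℝ K)
    (hC : IsConvexification B C) : IsWeakBarrier B K ↔ centralSymmetral K ⊆ C := by
  rw [isWeakBarrier_iff hB hK hne hc, hC.eq_setOf]
  constructor
  · rintro h _ ⟨_, ⟨x, hx, y, hy, rfl⟩, rfl⟩ θ
    have h₁ := inner_le_supportFun hK hx θ
    have h₂ := inner_le_supportFun hK hy (θ + Real.pi)
    rw [dir_add_pi, inner_neg_right, ← inner_neg_left, neg_neg] at h₂
    have h₃ := h θ
    simp only [inner_smul_left, inner_add_left]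
    simp only [map_div₀, map_one, map_ofNat]
    linarith
  · intro h θ
    obtain ⟨x, hx, hx'⟩ := exists_inner_eq_supportFun hK hne θ
    obtain ⟨y, hy, hy'⟩ := exists_inner_eq_supportFun hK hne (θ + Real.pi)
    have h₁ := h ⟨x + -y, ⟨x, hx, -y, by simpa using hy, rfl⟩, rfl⟩ θ
    rw [dir_add_pi] at hy'
    simp only [inner_smul_left, inner_add_left, inner_neg_left] at h₁
    simp only [map_div₀, map_one, map_ofNat] at h₁
    rw [inner_neg_right] at hy'
    linarith

/-! ### Sums over equally spaced directions. -/

theorem sum_range_shift_of_periodic {g : ℝ → ℝ} {δ : ℝ} {N : ℕ}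
    (hg : Function.Periodic g (N * δ)) (j : ℕ) :
    ∑ k ∈ Finset.range N, g (k * δ + j * δ) = ∑ k ∈ Finset.range N, g (k * δ) := by
  induction j with
  | zero => simp
  | succ j ih =>
    rw [← ih]
    have h₁ := Finset.sum_range_succ (fun k : ℕ => g (k * δ + j * δ)) N
    have h₂ := Finset.sum_range_succ' (fun k : ℕ => g (k * δ + j * δ)) N
    have h₃ : g (N * δ + j * δ) = g ((0 : ℕ) * δ + j * δ) := by
      rw [add_comm, hg]; simp
    have h₄ : ∑ k ∈ Finset.range N, g (k * δ + (j + 1 : ℕ) * δ) =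
        ∑ k ∈ Finset.range N, g ((k + 1 : ℕ) * δ + j * δ) :=
      Finset.sum_congr rfl fun k _ => by congr 1; push_cast; ring
    rw [h₄]
    linarith

theorem integral_abs_cos_period (a : ℝ) : ∫ x in a..a + 2 * Real.pi, |Real.cos x| = 4 := by
  have hper : Function.Periodic (fun x => |Real.cos x|) (2 * Real.pi) := fun x => by
    simp
  have hint : ∀ a b : ℝ, IntervalIntegrable (fun x => |Real.cos x|) volume a b :=
    fun a b => (by fun_prop : Continuous fun x => |Real.cos x|).intervalIntegrable a b
  rw [hper.intervalIntegral_add_eq a (-(Real.pi / 2)),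
    ← intervalIntegral.integral_add_adjacent_intervals (hint _ (Real.pi / 2)) (hint _ _)]
  have hpi := Real.pi_pos
  have h₁ : ∫ x in -(Real.pi / 2)..Real.pi / 2, |Real.cos x| =
      ∫ x in -(Real.pi / 2)..Real.pi / 2, Real.cos x := by
    refine intervalIntegral.integral_congr fun x hx => ?_
    rw [Set.uIcc_of_le (by linarith)] at hx
    exact abs_of_nonneg (Real.cos_nonneg_of_mem_Icc hx)
  have h₂ : ∫ x in Real.pi / 2..-(Real.pi / 2) + 2 * Real.pi, |Real.cos x| =
      ∫ x in Real.pi / 2..-(Real.pi / 2) + 2 * Real.pi, -Real.cos x := by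
    refine intervalIntegral.integral_congr fun x hx => ?_
    rw [Set.uIcc_of_le (by linarith)] at hx
    exact abs_of_nonpos (Real.cos_nonpos_of_pi_div_two_le_of_le hx.1 (by linarith [hx.2]))
  rw [h₁, h₂, intervalIntegral.integral_neg, integral_cos, integral_cos, Real.sin_add_two_pi,
    Real.sin_neg, Real.sin_pi_div_two]
  norm_num

/-- The integral of cos over the cell of width δ centred at kδ - θ is 2 sin(δ/2) cos(kδ - θ), and
the N cells tile one period of |cos|. -/
theorem sum_abs_cos_le {δ : ℝ} {N : ℕ} (hδ : 0 ≤ δ) (hN : N * δ = 2 * Real.pi) (θ : ℝ) :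
    2 * |Real.sin (δ / 2)| * ∑ k ∈ Finset.range N, |Real.cos (k * δ - θ)| ≤ 4 := by
  have hint : ∀ a b : ℝ, IntervalIntegrable (fun x => |Real.cos x|) volume a b :=
    fun a b => (by fun_prop : Continuous fun x => |Real.cos x|).intervalIntegrable a b
  have hadj := intervalIntegral.sum_integral_adjacent_intervals (μ := volume)
    (f := fun x => |Real.cos x|) (a := fun k : ℕ => k * δ - θ - δ / 2) (n := N)
    fun k _ => hint _ _
  have htot : ∫ x in ((0 : ℕ) : ℝ) * δ - θ - δ / 2..N * δ - θ - δ / 2, |Real.cos x| = 4 := by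
    rw [show (N : ℝ) * δ - θ - δ / 2 = ((0 : ℕ) : ℝ) * δ - θ - δ / 2 + 2 * Real.pi by
      rw [hN]; push_cast; ring]
    exact integral_abs_cos_period _
  rw [← htot, ← hadj, Finset.mul_sum]
  refine Finset.sum_le_sum fun k _ => ?_
  refine le_trans (le_of_eq ?_) (intervalIntegral.abs_integral_le_integral_abs ?_)
  · rw [integral_cos, Real.sin_sub_sin, abs_mul, abs_mul, abs_two]
    congr 4
    · push_cast; ring
    · push_cast; ring
  · push_cast; linarith

/-! ### Boundary length against a circumscribed equiangular polygon. -/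

theorem eq_smul_dir_add (y : Plane) (θ : ℝ) :
    y = (inner ℝ y (dir θ) : ℝ) • dir θ +
      (inner ℝ y (dir (θ + Real.pi / 2)) : ℝ) • dir (θ + Real.pi / 2) := by
  rw [inner_dir, inner_dir, Real.cos_add_pi_div_two, Real.sin_add_pi_div_two]
  have h2 := Real.sin_sq_add_cos_sq θ
  ext i; fin_cases i
  · simp [dir, Real.cos_add_pi_div_two, Real.sin_add_pi_div_two]
    linear_combination -(y 0) * h2
  · simp [dir, Real.cos_add_pi_div_two, Real.sin_add_pi_div_two]
    linear_combination -(y 1) * h2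

theorem inner_dir_add (y : Plane) (θ δ : ℝ) : inner ℝ y (dir (θ + δ)) =
    inner ℝ y (dir θ) * Real.cos δ + inner ℝ y (dir (θ + Real.pi / 2)) * Real.sin δ := by
  simp only [inner_dir, Real.cos_add, Real.sin_add, Real.cos_pi_div_two, Real.sin_pi_div_two]
  ring

/-- The part of the line with normal `dir θ` and offset `h₀` cut off by the two half-planes with
normals `dir (θ ± δ)`. -/
def polygonSide (θ δ h₀ h₁ h₂ : ℝ) : Set Plane :=
  {y | inner ℝ y (dir θ) = h₀ ∧ inner ℝ y (dir (θ + δ)) ≤ h₁ ∧ inner ℝ y (dir (θ - δ)) ≤ h₂}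

theorem mem_polygonSide_bounds {θ δ h₀ h₁ h₂ : ℝ} (hδ : 0 < Real.sin δ) {y : Plane}
    (hy : y ∈ polygonSide θ δ h₀ h₁ h₂) :
    inner ℝ y (dir (θ + Real.pi / 2)) ∈
      Set.Icc ((h₀ * Real.cos δ - h₂) / Real.sin δ) ((h₁ - h₀ * Real.cos δ) / Real.sin δ) := by
  obtain ⟨e₀, e₁, e₂⟩ := hy
  rw [sub_eq_add_neg] at e₂
  rw [inner_dir_add, e₀] at e₁ e₂
  rw [Real.cos_neg, Real.sin_neg] at e₂
  exact ⟨by rw [div_le_iff₀ hδ]; linarith, by rw [le_div_iff₀ hδ]; linarith⟩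

theorem length_nonneg_of_mem_polygonSide {θ δ h₀ h₁ h₂ : ℝ} (hδ : 0 < Real.sin δ) {y : Plane}
    (hy : y ∈ polygonSide θ δ h₀ h₁ h₂) :
    0 ≤ (h₁ + h₂ - 2 * Real.cos δ * h₀) / Real.sin δ := by
  have h := mem_polygonSide_bounds hδ hy
  have := h.1.trans h.2
  rw [div_le_div_iff_of_pos_right hδ] at this
  exact div_nonneg (by linarith) hδ.le

theorem hausdorffMeasure_polygonSide_le {θ δ h₀ h₁ h₂ : ℝ} (hδ : 0 < Real.sin δ) :
    (μH[1] : Measure Plane) (polygonSide θ δ h₀ h₁ h₂) ≤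
      ENNReal.ofReal ((h₁ + h₂ - 2 * Real.cos δ * h₀) / Real.sin δ) := by
  rcases (polygonSide θ δ h₀ h₁ h₂).eq_empty_or_nonempty with he | ⟨y₀, hy₀⟩
  · rw [he, measure_empty]; exact zero_le
  have hlen := length_nonneg_of_mem_polygonSide hδ hy₀
  set s := (h₀ * Real.cos δ - h₂) / Real.sin δ with hs
  set t := (h₁ - h₀ * Real.cos δ) / Real.sin δ with ht
  have hst : t - s = (h₁ + h₂ - 2 * Real.cos δ * h₀) / Real.sin δ := by
    rw [hs, ht]; ring
  have hsub : polygonSide θ δ h₀ h₁ h₂ ⊆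
      (fun r : ℝ => h₀ • dir θ + r • dir (θ + Real.pi / 2)) '' Set.Icc s t := by
    intro y hy
    refine ⟨_, mem_polygonSide_bounds hδ hy, ?_⟩
    conv_rhs => rw [eq_smul_dir_add y θ, hy.1]
  have hiso : Isometry (fun r : ℝ => h₀ • dir θ + r • dir (θ + Real.pi / 2)) :=
    (isometry_add_left (h₀ • dir θ)).comp (isometry_smul_dir _)
  refine (measure_mono hsub).trans ?_
  rw [hiso.hausdorffMeasure_image (Or.inl zero_le_one), hausdorffMeasure_real, Real.volume_Icc, hst]

/-- The inverse of `f` on the image of `S` is 1-Lipschitz. -/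
theorem hausdorffMeasure_le_of_expanding {X Y : Type*} [MetricSpace X] [MetricSpace Y]
    [MeasurableSpace X] [BorelSpace X] [MeasurableSpace Y] [BorelSpace Y] [Nonempty X]
    {S : Set X} {T : Set Y} {d : ℝ} (hd : 0 ≤ d) (f : X → Y) (hf : Set.MapsTo f S T)
    (h : ∀ x ∈ S, ∀ x' ∈ S, dist x x' ≤ dist (f x) (f x')) : μH[d] S ≤ μH[d] T := by
  have hinj : Set.InjOn f S := fun x hx x' hx' hxx' => by
    have := h x hx x' hx'
    rw [hxx', dist_self] at this
    exact dist_le_zero.1 this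
  have hl : LipschitzOnWith 1 (Function.invFunOn f S) (f '' S) := by
    refine LipschitzOnWith.of_dist_le_mul ?_
    rintro _ ⟨x, hx, rfl⟩ _ ⟨x', hx', rfl⟩
    rw [hinj.leftInvOn_invFunOn hx, hinj.leftInvOn_invFunOn hx', NNReal.coe_one, one_mul]
    exact h x hx x' hx'
  have := hl.hausdorffMeasure_image_le hd
  rw [hinj.leftInvOn_invFunOn.image_image, ENNReal.coe_one, ENNReal.one_rpow, one_mul] at this
  exact this.trans (measure_mono hf.image_subset)

/-- Since `v` and `v'` are outer normals at `x` and `x'`, the cross term in the expanded square of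
the new distance is nonnegative. -/
theorem dist_le_dist_add_smul_normal {K : Set Plane} {x x' v v' : Plane} (hx : x ∈ K) (hx' : x' ∈ K)
    (hv : ∀ z ∈ K, inner ℝ z v ≤ inner ℝ x v) (hv' : ∀ z ∈ K, inner ℝ z v' ≤ inner ℝ x' v')
    {t t' : ℝ} (ht : 0 ≤ t) (ht' : 0 ≤ t') :
    dist x x' ≤ dist (x + t • v) (x' + t' • v') := by
  rw [dist_eq_norm, dist_eq_norm]
  have h₁ : 0 ≤ t * inner ℝ (x - x') v :=
    mul_nonneg ht (by rw [inner_sub_left]; linarith [hv x' hx'])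
  have h₂ : 0 ≤ -(t' * inner ℝ (x - x') v') := by
    rw [← mul_neg]
    exact mul_nonneg ht' (by rw [inner_sub_left]; linarith [hv' x hx])
  have h₃ := norm_add_sq_real (x - x') (t • v - t' • v')
  rw [inner_sub_right, inner_smul_right, inner_smul_right] at h₃
  have h₄ : x + t • v - (x' + t' • v') = x - x' + (t • v - t' • v') := by abel
  rw [h₄]
  exact (sq_le_sq₀ (norm_nonneg _) (norm_nonneg _)).1
    (by nlinarith [sq_nonneg ‖t • v - t' • v'‖])

theorem exists_normal_of_mem_frontier {K : Set Plane} (hc : Convex ℝ K)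
    (hi : (interior K).Nonempty) {x : Plane} (hx : x ∈ frontier K) :
    ∃ v : Plane, v ≠ 0 ∧ ∀ z ∈ K, inner ℝ z v ≤ inner ℝ x v := by
  obtain ⟨f, hf⟩ := geometric_hahn_banach_open_point hc.interior isOpen_interior hx.2
  set v := (InnerProductSpace.toDual ℝ Plane).symm f with hv
  have hfv : ∀ y, f y = inner ℝ y v := fun y => by
    rw [real_inner_comm, InnerProductSpace.toDual_symm_apply]
  refine ⟨v, ?_, fun z hz => ?_⟩
  · intro h0
    obtain ⟨y, hy⟩ := hi
    have := hf y hy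
    simp [hfv, h0] at this
  · have hz' : z ∈ closure (interior K) := by
      rw [hc.closure_interior_eq_closure_of_nonempty_interior hi]
      exact subset_closure hz
    rw [← hfv, ← hfv]
    exact closure_minimal (t := {y | f y ≤ f x}) (fun y hy => (hf y hy).le)
      (isClosed_le f.continuous continuous_const) hz'

/-- The directions come in opposite pairs, so otherwise `v` would be orthogonal to all of them, in
particular to the independent ones k = 0 and k = 1. -/
theorem exists_inner_dir_pos {v : Plane} (hv : v ≠ 0) {M : ℕ} (hM : 2 ≤ M) :
    ∃ k ∈ Finset.range (2 * M), 0 < inner ℝ v (dir (k * (Real.pi / M))) := by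
  by_contra! h
  have hM0 : (M : ℝ) ≠ 0 := by positivity
  have key : ∀ k < M, inner ℝ v (dir (k * (Real.pi / M))) = 0 := by
    intro k hk
    have h₁ := h k (by simp; omega)
    have h₂ := h (k + M) (by simp; omega)
    rw [show ((k + M : ℕ) : ℝ) * (Real.pi / M) = k * (Real.pi / M) + Real.pi by
      push_cast; field_simp, dir_add_pi, inner_neg_right] at h₂
    linarith
  have h₀ := key 0 (by omega)
  have h₁ := key 1 (by omega)
  rw [inner_dir] at h₀ h₁
  simp only [Nat.cast_zero, zero_mul, Real.cos_zero, mul_one, Real.sin_zero, mul_zero,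
    add_zero] at h₀
  have hs : 0 < Real.sin ((1 : ℕ) * (Real.pi / M)) := by
    refine Real.sin_pos_of_pos_of_lt_pi (by positivity) ?_
    rw [Nat.cast_one, one_mul]
    exact div_lt_self Real.pi_pos (by exact_mod_cast hM)
  rw [h₀, zero_mul, zero_add, mul_eq_zero, or_iff_left hs.ne'] at h₁
  exact hv (by ext i; fin_cases i <;> simp [h₀, h₁])

/-- The ray from `x` along `v` leaves the circumscribed polygon through some side; `t` is the exit
time, the least one over the sides facing `v`. -/
theorem exists_add_smul_mem_polygonSide {K : Set Plane} (hK : IsCompact K) {x v : Plane}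
    (hx : x ∈ K) (hv : v ≠ 0) {M : ℕ} (hM : 2 ≤ M) :
    ∃ t : ℝ, 0 ≤ t ∧ ∃ k ∈ Finset.range (2 * M), x + t • v ∈
      polygonSide (k * (Real.pi / M)) (Real.pi / M) (supportFun K (k * (Real.pi / M)))
        (supportFun K (k * (Real.pi / M) + Real.pi / M))
        (supportFun K (k * (Real.pi / M) - Real.pi / M)) := by
  have hM0 : (M : ℝ) ≠ 0 := by positivity
  set δ := Real.pi / M with hδ
  have hMδ : ((2 * M : ℕ) : ℝ) * δ = 2 * Real.pi := by rw [hδ]; push_cast; field_simp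
  obtain ⟨k₀, hk₀, hk₀'⟩ := exists_inner_dir_pos hv hM
  obtain ⟨k, hk, hmin⟩ := Finset.exists_min_image
    ((Finset.range (2 * M)).filter fun k : ℕ => 0 < inner ℝ v (dir (k * δ)))
    (fun k : ℕ => (supportFun K (k * δ) - inner ℝ x (dir (k * δ))) / inner ℝ v (dir (k * δ)))
    ⟨k₀, Finset.mem_filter.2 ⟨hk₀, hk₀'⟩⟩
  rw [Finset.mem_filter] at hk
  set t := (supportFun K (k * δ) - inner ℝ x (dir (k * δ))) / inner ℝ v (dir (k * δ)) with ht
  have ht0 : 0 ≤ t := div_nonneg (sub_nonneg.2 (inner_le_supportFun hK hx _)) hk.2.le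
  have hle : ∀ j < 2 * M, inner ℝ (x + t • v) (dir (j * δ)) ≤ supportFun K (j * δ) := by
    intro j hj
    rw [inner_add_left, inner_smul_left, conj_trivial]
    rcases lt_or_ge 0 (inner ℝ v (dir (j * δ))) with hpos | hneg
    · have := hmin j (Finset.mem_filter.2 ⟨Finset.mem_range.2 hj, hpos⟩)
      rw [le_div_iff₀ hpos] at this
      linarith
    · have := inner_le_supportFun hK hx (j * δ)
      have := mul_nonpos_of_nonneg_of_nonpos ht0 hneg
      linarith
  refine ⟨t, ht0, k, hk.1, ?_, ?_, ?_⟩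
  · rw [inner_add_left, inner_smul_left, conj_trivial, ht, div_mul_cancel₀ _ hk.2.ne']
    ring
  · have hk' := Finset.mem_range.1 hk.1
    rcases Nat.lt_or_ge (k + 1) (2 * M) with h | h
    · have := hle (k + 1) h
      rwa [Nat.cast_succ, add_mul, one_mul] at this
    -- The last side is adjacent to side 0, by periodicity.
    · obtain h : k + 1 = 2 * M := by omega
      have h' : (k : ℝ) * δ + δ = 0 + 2 * Real.pi := by
        rw [zero_add, ← hMδ, ← h]; push_cast; ring
      rw [h', dir_add_two_pi, supportFun_add_two_pi]
      simpa using hle 0 (by omega)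
  · have hk' := Finset.mem_range.1 hk.1
    rcases Nat.eq_zero_or_pos k with h | h
    · have := hle (2 * M - 1) (by omega)
      rw [Nat.cast_sub (by omega), sub_mul, hMδ, Nat.cast_one, one_mul,
        show 2 * Real.pi - δ = (k : ℝ) * δ - δ + 2 * Real.pi by rw [h]; push_cast; ring,
        dir_add_two_pi, supportFun_add_two_pi] at this
      exact this
    · have := hle (k - 1) (by omega)
      rwa [Nat.cast_sub h, sub_mul, Nat.cast_one, one_mul] at this

theorem hausdorffMeasure_frontier_le {K : Set Plane} (hK : IsCompact K) (hc : Convex ℝ K)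
    (hi : (interior K).Nonempty) {M : ℕ} (hM : 2 ≤ M) :
    (μH[1] : Measure Plane) (frontier K) ≤
      ENNReal.ofReal (2 * (1 - Real.cos (Real.pi / M)) / Real.sin (Real.pi / M) *
        ∑ k ∈ Finset.range (2 * M), supportFun K (k * (Real.pi / M))) := by
  have hM0 : (M : ℝ) ≠ 0 := by positivity
  have hne : K.Nonempty := hi.mono interior_subset
  have hfr : frontier K ⊆ K := hK.isClosed.frontier_subset
  have hex : ∀ x : Plane, ∃ v : Plane, ∃ t : ℝ, x ∈ frontier K →
      (∀ z ∈ K, inner ℝ z v ≤ inner ℝ x v) ∧ 0 ≤ t ∧ ∃ k ∈ Finset.range (2 * M), x + t • v ∈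
      polygonSide (k * (Real.pi / M)) (Real.pi / M) (supportFun K (k * (Real.pi / M)))
        (supportFun K (k * (Real.pi / M) + Real.pi / M))
        (supportFun K (k * (Real.pi / M) - Real.pi / M)) := by
    intro x
    by_cases hx : x ∈ frontier K
    · obtain ⟨v, hv, hv'⟩ := exists_normal_of_mem_frontier hc hi hx
      obtain ⟨t, ht, h⟩ := exists_add_smul_mem_polygonSide hK (hfr hx) hv hM
      exact ⟨v, t, fun _ => ⟨hv', ht, h⟩⟩
    · exact ⟨0, 0, fun h => absurd h hx⟩
  choose v t hvt using hex
  set δ := Real.pi / M with hδ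
  have hMδ : ((2 * M : ℕ) : ℝ) * δ = 2 * Real.pi := by rw [hδ]; push_cast; field_simp
  have hsin : 0 < Real.sin δ :=
    Real.sin_pos_of_pos_of_lt_pi (by positivity) (div_lt_self Real.pi_pos (by exact_mod_cast hM))
  have hper : Function.Periodic (supportFun K) ((2 * M : ℕ) * δ) := by
    rw [hMδ]; exact supportFun_add_two_pi K
  have hlen : ∀ k : ℕ, 0 ≤ (supportFun K (k * δ + δ) + supportFun K (k * δ - δ) -
      2 * Real.cos δ * supportFun K (k * δ)) / Real.sin δ := by
    intro k
    obtain ⟨x, hx, hx'⟩ := exists_inner_eq_supportFun hK hne (k * δ)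
    exact length_nonneg_of_mem_polygonSide hsin (y := x)
      ⟨hx', inner_le_supportFun hK hx _, inner_le_supportFun hK hx _⟩
  calc _ ≤ (μH[1] : Measure Plane) (⋃ k ∈ Finset.range (2 * M), polygonSide (k * δ) δ
          (supportFun K (k * δ)) (supportFun K (k * δ + δ)) (supportFun K (k * δ - δ))) := by
        refine hausdorffMeasure_le_of_expanding zero_le_one (fun x => x + t x • v x) ?_ ?_
        · intro x hx
          obtain ⟨-, -, k, hk, h⟩ := hvt x hx
          exact Set.mem_iUnion₂.2 ⟨k, hk, h⟩
        · intro x hx x' hx'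
          exact dist_le_dist_add_smul_normal (hfr hx) (hfr hx') (hvt x hx).1 (hvt x' hx').1
            (hvt x hx).2.1 (hvt x' hx').2.1
    _ ≤ ∑ k ∈ Finset.range (2 * M), ENNReal.ofReal ((supportFun K (k * δ + δ) +
          supportFun K (k * δ - δ) - 2 * Real.cos δ * supportFun K (k * δ)) / Real.sin δ) :=
        (measure_biUnion_finset_le _ _).trans
          (Finset.sum_le_sum fun k _ => hausdorffMeasure_polygonSide_le hsin)
    _ = _ := by
        rw [← ENNReal.ofReal_sum_of_nonneg fun k _ => hlen k, ← Finset.sum_div,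
          Finset.sum_sub_distrib, Finset.sum_add_distrib, ← Finset.mul_sum]
        -- Each neighbouring support value sums to Σ h(kδ) over a full turn, leaving the factor 2(1
        -- - cos δ)/sin δ.
        have h₁ := sum_range_shift_of_periodic hper 1
        have h₂ := sum_range_shift_of_periodic (g := fun r => supportFun K (r - δ)) (δ := δ)
          (N := 2 * M) (fun r => by simpa [add_sub_right_comm] using hper (r - δ)) 1
        simp only [Nat.cast_one, one_mul, add_sub_cancel_right] at h₁ h₂
        rw [h₁, ← h₂]
        congr 1
        ring

/-! ### Jones' bound. -/

theorem sum_abs_inner_dir_le (e : Plane) {δ : ℝ} {N : ℕ} (hδ : 0 ≤ δ)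
    (hN : N * δ = 2 * Real.pi) :
    |Real.sin (δ / 2)| * ∑ k ∈ Finset.range N, |inner ℝ e (dir (k * δ))| ≤ 2 * ‖e‖ := by
  have he : ∀ θ, |inner ℝ e (dir θ)| = ‖e‖ * |Real.cos (θ - horizontalAngle e)| := by
    intro θ
    conv_lhs => rw [eq_norm_smul_dir_horizontalAngle e]
    rw [inner_smul_left, inner_dir, Real.cos_sub, conj_trivial, abs_mul, abs_norm]
    simp [dir, mul_comm]
  simp only [he]
  rw [← Finset.mul_sum]
  have := mul_le_mul_of_nonneg_left (sum_abs_cos_le hδ hN (horizontalAngle e)) (norm_nonneg e)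
  linarith

theorem hausdorffMeasure_frontier_le_of_width_le {K : Set Plane} (hK : IsCompact K)
    (hc : Convex ℝ K) (hi : (interior K).Nonempty) {ι : Type*} [Fintype ι] {e : ι → Plane}
    (hw : ∀ θ, supportFun K θ + supportFun K (θ + Real.pi) ≤ ∑ i, |inner ℝ (e i) (dir θ)|) :
    (μH[1] : Measure Plane) (frontier K) ≤ ENNReal.ofReal (2 * ∑ i, ‖e i‖) := by
  have hbound : ∀ M : ℕ, 2 ≤ M → (μH[1] : Measure Plane) (frontier K) ≤
      ENNReal.ofReal (2 * (∑ i, ‖e i‖) / Real.cos (Real.pi / M / 2)) := by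
    intro M hM
    refine (hausdorffMeasure_frontier_le hK hc hi hM).trans (ENNReal.ofReal_le_ofReal ?_)
    have hM0 : (0 : ℝ) < M := by positivity
    have hpi := Real.pi_pos
    have hδpi : Real.pi / M < Real.pi := div_lt_self hpi (by exact_mod_cast hM)
    have hδ0 : 0 < Real.pi / M := by positivity
    have hMδ' : (M : ℝ) * (Real.pi / M) = Real.pi := by field_simp
    set δ := Real.pi / M with hδ
    have hMδ : ((2 * M : ℕ) : ℝ) * δ = 2 * Real.pi := by push_cast; linarith
    have hper : Function.Periodic (supportFun K) ((2 * M : ℕ) * δ) := by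
      rw [hMδ]; exact supportFun_add_two_pi K
    have hs : 0 < Real.sin (δ / 2) := Real.sin_pos_of_pos_of_lt_pi (by linarith) (by linarith)
    have hcos : 0 < Real.cos (δ / 2) := Real.cos_pos_of_mem_Ioo ⟨by linarith, by linarith⟩
    -- The factor is 2 tan(δ/2); its sine cancels against the one in `sum_abs_inner_dir_le`.
    have hcoef : 2 * (1 - Real.cos δ) / Real.sin δ = 2 * Real.sin (δ / 2) / Real.cos (δ / 2) := by
      have h₁ : Real.cos δ = 1 - 2 * Real.sin (δ / 2) ^ 2 := by
        rw [show δ = 2 * (δ / 2) by ring, Real.cos_two_mul, Real.cos_sq']; ring_nf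
      have h₂ : Real.sin δ = 2 * Real.sin (δ / 2) * Real.cos (δ / 2) := by
        rw [← Real.sin_two_mul]; ring_nf
      rw [h₁, h₂]
      field_simp
      ring
    have hsum : 2 * ∑ k ∈ Finset.range (2 * M), supportFun K (k * δ) ≤
        ∑ i, ∑ k ∈ Finset.range (2 * M), |inner ℝ (e i) (dir (k * δ))| := by
      -- A shift by M steps is a rotation by π, so twice the sum of support values is a sum of
      -- widths.
      have h₁ := sum_range_shift_of_periodic hper M
      rw [hMδ'] at h₁
      rw [two_mul]
      nth_rw 2 [← h₁]
      rw [← Finset.sum_add_distrib, Finset.sum_comm]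
      exact Finset.sum_le_sum fun k _ => hw _
    have hsin : Real.sin (δ / 2) * ∑ i, ∑ k ∈ Finset.range (2 * M),
        |inner ℝ (e i) (dir (k * δ))| ≤ 2 * ∑ i, ‖e i‖ := by
      rw [Finset.mul_sum, Finset.mul_sum]
      refine Finset.sum_le_sum fun i _ => ?_
      have := sum_abs_inner_dir_le (e i) hδ0.le hMδ
      rwa [abs_of_pos hs] at this
    rw [hcoef, div_mul_eq_mul_div]
    refine div_le_div_of_nonneg_right ?_ hcos.le
    have := mul_le_mul_of_nonneg_left hsum hs.le
    linarith
  have hlim : Filter.Tendsto (fun M : ℕ => ENNReal.ofReal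
      (2 * (∑ i, ‖e i‖) / Real.cos (Real.pi / M / 2))) Filter.atTop
      (nhds (ENNReal.ofReal (2 * ∑ i, ‖e i‖))) := by
    have h₁ : Filter.Tendsto (fun M : ℕ => Real.pi / M / 2) Filter.atTop (nhds 0) := by
      simpa using (tendsto_const_div_atTop_nhds_zero_nat Real.pi).div_const 2
    have h₂ := (Real.continuous_cos.tendsto 0).comp h₁
    rw [Real.cos_zero] at h₂
    have h₃ := (tendsto_const_nhds (x := 2 * ∑ i, ‖e i‖)).div h₂ one_ne_zero
    rw [div_one] at h₃
    exact (ENNReal.continuous_ofReal.tendsto _).comp h₃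
  exact ge_of_tendsto hlim (Filter.eventually_atTop.2 ⟨2, hbound⟩)

theorem hausdorffMeasure_iUnion_segment {m : ℕ} {a b : Fin m → Plane}
    (h : ∀ i j, i ≠ j → (segment ℝ (a i) (b i) ∩ segment ℝ (a j) (b j)).Subsingleton) :
    (μH[1] : Measure Plane) (⋃ i, segment ℝ (a i) (b i)) =
      ENNReal.ofReal (∑ i, ‖b i - a i‖) := by
  have := Measure.nullSingletonClass_hausdorff Plane (d := 1) one_pos
  rw [measure_iUnion₀ (fun i j hij => (h i j hij).measure_zero _) fun i => ?_, tsum_fintype,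
    ENNReal.ofReal_sum_of_nonneg fun _ _ => norm_nonneg _]
  · refine Finset.sum_congr rfl fun i _ => ?_
    rw [hausdorffMeasure_segment, edist_comm, edist_dist, dist_eq_norm]
  · rw [segment_eq_image']
    exact ((isCompact_Icc.image (by fun_prop)).measurableSet).nullMeasurableSet

theorem IsWeakBarrier.hausdorffMeasure_frontier_div_two_le {B K : Set Plane}
    (hB : IsFiniteUnionOfSegments B) (hK : IsCompact K) (hc : Convex ℝ K)
    (hi : (interior K).Nonempty) (hw : IsWeakBarrier B K) :
    (μH[1] : Measure Plane) (frontier K) / 2 ≤ (μH[1] : Measure Plane) B := by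
  obtain ⟨m, a, b, h⟩ := exists_isOrderedDecomposition hB
  rw [isWeakBarrier_iff hB hK (hi.mono interior_subset) hc] at hw
  simp only [← sum_abs_inner_eq_totalProjectionLength h] at hw
  have := hausdorffMeasure_frontier_le_of_width_le hK hc hi hw
  rw [ENNReal.ofReal_mul zero_le_two, ENNReal.ofReal_ofNat] at this
  rw [h.eq_iUnion, hausdorffMeasure_iUnion_segment h.nonoverlapping]
  exact ENNReal.div_le_of_le_mul' this

theorem proposition1 (B : Set Plane) (hB : IsFiniteUnionOfSegments B)
    (K : ConvexBody Plane) (hK : (interior (K : Set Plane)).Nonempty) :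
    (∃! C : Set Plane, IsConvexification B C) ∧
    (∀ C : Set Plane, IsConvexification B C →
      (IsWeakBarrier B (K : Set Plane) ↔ centralSymmetral (K : Set Plane) ⊆ C)) ∧
    (IsWeakBarrier B (K : Set Plane) →
      (μH[1] : Measure Plane) (frontier (K : Set Plane)) / 2 ≤ (μH[1] : Measure Plane) B) :=
  ⟨existsUnique_isConvexification hB,
    fun _ hC => isWeakBarrier_iff_centralSymmetral_subset hB K.isCompact K.nonempty K.convex hC,
    IsWeakBarrier.hausdorffMeasure_frontier_div_two_le hB K.isCompact K.convex hK⟩
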